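/- Let $\mathcal{R}$ be a $\delta$-ring of subsets of a set $\Omega$ (a ring of sets closed under countable intersections), let $E$ be a real Banach space, and let $m\colon\mathcal{R}\to E$ be a vector measure, i.e. $\sum_n m(A_n)$ converges to $m(\bigcup_n A_n)$ in $E$ for every sequence $(A_n)\subset\mathcal{R}$ of pairwise disjoint sets with $\bigcup_n A_n\in\mathcal{R}$. Let $\mathcal{R}^{loc}$ be the $\sigma$-algebra of all $A\subset\Omega$ with $A\cap B\in\mathcal{R}$ for all $B\in\mathcal{R}$. For $x^*\in E^*$ let $|x^*m|\colon\mathcal{R}^{loc}\to[0,\infty]$ be the variation of the real measure $x^*m=x^*\circ m$. Let $L^1(m)$ be the space of $\mathcal{R}^{loc}$-measurable functions $f\colon\Omega\to\mathbb{R}$ (identified when they are equal outside a set $A\in\mathcal{R}^{loc}$ with $m(B)=0$ for all $B\in\mathcal{R}$, $B\subset A$) such that $f\in L^1(|x^*m|)$ for every $x^*\in E^*$ and such that for every $A\in\mathcal{R}^{loc}$ there is $\int_A f\,dm\in E$ with $x^*\big(\int_A f\,dm\big)=\int_A f\,d(x^*m)$ for all $x^*\in E^*$. Its norm is $\|f\|_m=\sup_{\|x^*\|\le1}\int_\Omega|f|\,d|x^*m|$.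 The integration operator $I_m\colon L^1(m)\to E$ is $I_m(f)=\int_\Omega f\,dm$. Let $q\in(0,\infty)$. A linear operator $T\colon L^1(m)\to F$ into a Banach space $F$ is called $q$-concave if there is a constant $C>0$ such that $$\Big(\sum_{j=1}^n\|T(f_j)\|_F^q\Big)^{1/q}\le C\,\Big\|\Big(\sum_{j=1}^n|f_j|^q\Big)^{1/q}\Big\|_m$$ for every finite family $f_1,\dots,f_n\in L^1(m)$, and $L^1(m)$ is called $q$-concave if its identity map $L^1(m)\to L^1(m)$ is $q$-concave. Then $I_m\colon L^1(m)\to E$ is $q$-concave if and only if $L^1(m)$ is $q$-concave. -/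

import Mathlib

open MeasureTheory Set Filter Topology
open scoped ENNReal NNReal

/-- A `δ`-ring of subsets of `Ω`: a ring of sets closed under countable intersections. -/
class DeltaRing (Ω : Type*) where
  /-- the members of the `δ`-ring -/
  ringSets : Set (Set Ω)
  isSetRing : IsSetRing ringSets
  iInter_mem : ∀ A : ℕ → Set Ω, (∀ n, A n ∈ ringSets) → (⋂ n, A n) ∈ ringSets

namespace DeltaRing

variable {Ω : Type*} [DeltaRing Ω]

theorem inter_mem {A B : Set Ω} (hA : A ∈ ringSets) (hB : B ∈ ringSets) : A ∩ B ∈ ringSets (Ω := Ω) :=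
  isSetRing.inter_mem hA hB

/-- A `δ`-ring is closed under countable unions that stay inside one of its members. -/
theorem iUnion_inter_mem {A : ℕ → Set Ω} {B : Set Ω} (hB : B ∈ ringSets)
    (h : ∀ n, A n ∩ B ∈ ringSets) : (⋃ n, A n) ∩ B ∈ ringSets (Ω := Ω) := by
  have e : (⋃ n, A n) ∩ B = B \ ⋂ n, (B \ (A n ∩ B)) := by
    ext x
    simp only [mem_inter_iff, mem_iUnion, Set.mem_sdiff, Set.mem_iInter, not_forall, not_and,
      not_not]
    constructor
    · rintro ⟨⟨n, hn⟩, hx⟩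
      exact ⟨hx, n, fun _ => ⟨hn, hx⟩⟩
    · rintro ⟨hx, n, hn⟩
      exact ⟨⟨n, (hn hx).1⟩, hx⟩
  rw [e]
  exact isSetRing.sdiff_mem hB (iInter_mem _ fun n => isSetRing.sdiff_mem hB (h n))

/-- The `σ`-algebra `𝓡^loc` of all sets `A` with `A ∩ B ∈ 𝓡` for every `B ∈ 𝓡`. It is the
`σ`-algebra that `Ω` carries in all that follows, so `MeasurableSet` refers to it. -/
instance loc : MeasurableSpace Ω where
  MeasurableSet' A := ∀ B ∈ ringSets, A ∩ B ∈ ringSets (Ω := Ω)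
  measurableSet_empty B _ := by simpa using isSetRing.empty_mem
  measurableSet_compl A hA B hB := by
    have e : Aᶜ ∩ B = B \ (A ∩ B) := by ext x; simp; tauto
    rw [e]
    exact isSetRing.sdiff_mem hB (hA B hB)
  measurableSet_iUnion A hA B hB := iUnion_inter_mem hB fun n => hA n B hB

theorem measurableSet_iff {A : Set Ω} :
    MeasurableSet A ↔ ∀ B ∈ ringSets, A ∩ B ∈ ringSets (Ω := Ω) := Iff.rfl

theorem measurableSet_of_mem {A : Set Ω} (hA : A ∈ ringSets) : MeasurableSet A :=
  fun _ hB => inter_mem hA hB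

theorem mem_of_subset {A B : Set Ω} (hA : MeasurableSet A) (hB : B ∈ ringSets) (h : A ⊆ B) :
    A ∈ ringSets := by
  simpa [inter_eq_self_of_subset_left h] using hA B hB

end DeltaRing

open DeltaRing

/-- A vector measure on the `δ`-ring of `Ω`: for pairwise disjoint `A₀, A₁, …` in the `δ`-ring
whose union is in the `δ`-ring, `∑ m(Aₙ)` converges to `m(⋃ Aₙ)`. (All rearrangements of the
sequence satisfy the same condition, so convergence of the series is unconditional.) The values
outside the `δ`-ring carry no meaning and are never used. -/
structure RingVectorMeasure (Ω : Type*) [DeltaRing Ω] (E : Type*) [AddCommMonoid E]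
    [TopologicalSpace E] where
  toFun : Set Ω → E
  hasSum' : ∀ A : ℕ → Set Ω, (∀ n, A n ∈ ringSets) → Pairwise (Function.onFun Disjoint A) →
    (⋃ n, A n) ∈ ringSets → HasSum (fun n => toFun (A n)) (toFun (⋃ n, A n))

namespace RingVectorMeasure

variable {Ω : Type*} [DeltaRing Ω]

instance {E : Type*} [AddCommMonoid E] [TopologicalSpace E] :
    CoeFun (RingVectorMeasure Ω E) (fun _ => Set Ω → E) := ⟨toFun⟩

section Scalar

/-! ### Real measures on a `δ`-ring -/

theorem empty {E : Type*} [NormedAddCommGroup E] (m : RingVectorMeasure Ω E) : m ∅ = 0 := by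
  have h := m.hasSum' (fun _ => ∅) (fun _ => isSetRing.empty_mem)
    (fun _ _ _ => by simp [Function.onFun]) (by simpa using isSetRing.empty_mem)
  exact tendsto_nhds_unique (tendsto_const_nhds (x := m ∅) (f := atTop (α := ℕ)))
    (by simpa [Nat.cofinite_eq_atTop] using h.summable.tendsto_cofinite_zero)

/-- The trace `B ↦ m(B ∩ A)` of a vector measure on a member `A` of the `δ`-ring, a vector
measure on the `σ`-algebra `𝓡^loc`. -/
noncomputable def trace {E : Type*} [NormedAddCommGroup E] (m : RingVectorMeasure Ω E)
    (A : Set Ω) (hA : A ∈ ringSets) : VectorMeasure Ω E := by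
  classical
  exact
  { measureOf' := fun B => if MeasurableSet B then m (B ∩ A) else 0
    empty' := by simp [m.empty]
    not_measurable' := fun B hB => by simp [hB]
    m_iUnion' := fun f hf hd => by
      simp only [hf, MeasurableSet.iUnion hf, if_true, iUnion_inter]
      refine m.hasSum' (fun n => f n ∩ A) (fun n => hf n A hA) (fun i j hij => ?_) ?_
      · exact (hd hij).mono inter_subset_left inter_subset_left
      · rw [← iUnion_inter]; exact MeasurableSet.iUnion hf A hA }

theorem trace_apply {E : Type*} [NormedAddCommGroup E] (m : RingVectorMeasure Ω E)
    {A : Set Ω} (hA : A ∈ ringSets) {B : Set Ω} (hB : MeasurableSet B) :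
    m.trace A hA B = m (B ∩ A) := by
  simp only [trace]
  exact if_pos hB

/-- Composition `x* m` of a vector measure with a continuous linear map. -/
def comp {E F : Type*} [NormedAddCommGroup E] [NormedSpace ℝ E] [NormedAddCommGroup F]
    [NormedSpace ℝ F] (m : RingVectorMeasure Ω E) (T : E →L[ℝ] F) : RingVectorMeasure Ω F where
  toFun A := T (m A)
  hasSum' A hA hd hU := (m.hasSum' A hA hd hU).mapL T

variable (l : RingVectorMeasure Ω ℝ)

open scoped Classical in
/-- The set function equal to `g(l(A))` on the `δ`-ring and to `0` elsewhere. -/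
noncomputable def gauge (g : ℝ → ℝ≥0∞) (A : Set Ω) : ℝ≥0∞ := if A ∈ ringSets then g (l A) else 0

theorem gauge_empty {g : ℝ → ℝ≥0∞} (h0 : g 0 = 0) : l.gauge g ∅ = 0 := by
  simp [gauge, l.empty, h0]

theorem gauge_subadditive {g : ℝ → ℝ≥0∞}
    (hg : ∀ (a : ℕ → ℝ) (s : ℝ), HasSum a s → g s ≤ ∑' n, g (a n)) :
    IsSigmaSubadditiveSetFun (l.gauge g) := by
  intro s hs
  by_cases hU : (⋃ n, (s n).val) ∈ ringSets
  · have hm : ∀ n, (s n).val ∈ ringSets := fun n =>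
      mem_of_subset (s n).2 hU (subset_iUnion (fun n => (s n).val) n)
    simp only [gauge, hU, hm, if_true]
    exact hg _ _ (l.hasSum' (fun n => (s n).val) hm hs hU)
  · simp [gauge, hU]

theorem enorm_le_tsum (a : ℕ → ℝ) (s : ℝ) (h : HasSum a s) : ‖s‖ₑ ≤ ∑' n, ‖a n‖ₑ := by
  rw [← h.tsum_eq]; exact enorm_tsum_le_tsum_enorm

theorem ofReal_le_tsum (a : ℕ → ℝ) (s : ℝ) (h : HasSum a s) :
    ENNReal.ofReal s ≤ ∑' n, ENNReal.ofReal (a n) := by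
  refine le_of_tendsto ((ENNReal.continuous_ofReal.tendsto s).comp h.tendsto_sum_nat)
    (Eventually.of_forall fun n => ?_)
  refine le_trans ?_ (ENNReal.sum_le_tsum (Finset.range n))
  simp only [Function.comp]
  induction n with
  | zero => simp
  | succ k ih =>
    rw [Finset.sum_range_succ, Finset.sum_range_succ]
    exact ENNReal.ofReal_add_le.trans (add_le_add ih le_rfl)

theorem ofReal_neg_le_tsum (a : ℕ → ℝ) (s : ℝ) (h : HasSum a s) :
    ENNReal.ofReal (-s) ≤ ∑' n, ENNReal.ofReal (-a n) :=
  ofReal_le_tsum (fun n => -a n) (-s) h.neg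

/-- The variation `|l|` of a real measure on a `δ`-ring, a measure on `𝓡^loc`; see
`variation_apply` for the usual formula. -/
noncomputable def variation : Measure Ω :=
  preVariation (l.gauge fun t => ‖t‖ₑ) (l.gauge_subadditive enorm_le_tsum)
    (l.gauge_empty (by simp))

/-- The positive variation `l⁺(A) = sup ∑ max(l(Aⱼ), 0)`, over the finite disjoint families
`(Aⱼ)` in the `δ`-ring with `Aⱼ ⊆ A`. -/
noncomputable def posVariation : Measure Ω :=
  preVariation (l.gauge fun t => ENNReal.ofReal t) (l.gauge_subadditive ofReal_le_tsum)
    (l.gauge_empty (by simp))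

/-- The negative variation `l⁻(A) = sup ∑ max(-l(Aⱼ), 0)`, over the finite disjoint families
`(Aⱼ)` in the `δ`-ring with `Aⱼ ⊆ A`. -/
noncomputable def negVariation : Measure Ω :=
  preVariation (l.gauge fun t => ENNReal.ofReal (-t)) (l.gauge_subadditive ofReal_neg_le_tsum)
    (l.gauge_empty (by simp))

theorem preVariation_eq {f : Set Ω → ℝ≥0∞} (hf : IsSigmaSubadditiveSetFun f) (hf' : f ∅ = 0)
    {A : Set Ω} (hA : MeasurableSet A) :
    preVariation f hf hf' A =
      ⨆ (P : Finpartition (⟨A, hA⟩ : Subtype MeasurableSet)), ∑ p ∈ P.parts, f p := by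
  rw [preVariation_apply, VectorMeasure.ennrealToMeasure_apply hA, ennrealPreVariation_apply,
    preVariationFun_apply _ hA]

theorem preVariation_le {f : Set Ω → ℝ≥0∞} (hf : IsSigmaSubadditiveSetFun f) (hf' : f ∅ = 0)
    {μ : Measure Ω} {A : Set Ω} (hA : MeasurableSet A)
    (h : ∀ B ⊆ A, MeasurableSet B → f B ≤ μ B) : preVariation f hf hf' A ≤ μ A := by
  rw [preVariation_eq hf hf' hA]
  refine iSup_le fun i => ?_
  calc ∑ x ∈ i.parts, f x ≤ ∑ x ∈ i.parts, μ x := Finset.sum_le_sum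
        (fun s hs => h s (i.le hs) s.property)
    _ = μ (i.parts.sup Subtype.val) := by
      rw [Finset.sup_set_eq_biUnion]
      refine (measure_biUnion_finset ?_ fun b _ => b.property).symm
      intro a ha b hb hab
      simpa [disjoint_iff, Subtype.ext_iff] using i.disjoint ha hb hab
    _ ≤ μ A := by
      rw [Finset.sup_set_eq_biUnion]
      exact measure_mono <| iUnion₂_subset fun _ hp => Subtype.coe_le_coe.mpr (i.le hp)

theorem le_preVariation {f : Set Ω → ℝ≥0∞} (hf : IsSigmaSubadditiveSetFun f) (hf' : f ∅ = 0)
    {A : Set Ω} (hA : MeasurableSet A) : f A ≤ preVariation f hf hf' A := by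
  rw [preVariation_eq hf hf' hA]
  by_cases h : (⟨A, hA⟩ : Subtype MeasurableSet) = ⊥
  · have : A = ∅ := congrArg Subtype.val h
    subst this
    simp [hf']
  · refine le_trans ?_ (le_iSup _ (Finpartition.indiscrete h))
    simp

/-- `|l|(A)` is the supremum of `∑ |l(Aⱼ)|` over the finite disjoint families `(Aⱼ)` of members
of the `δ`-ring that are contained in `A`. -/
theorem variation_apply {A : Set Ω} (hA : MeasurableSet A) :
    l.variation A = ⨆ (P : Finset (Set Ω)) (_ : ∀ B ∈ P, B ∈ ringSets ∧ B ⊆ A)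
      (_ : (P : Set (Set Ω)).PairwiseDisjoint id), ∑ B ∈ P, ‖l B‖ₑ := by
  classical
  apply le_antisymm
  · rw [variation, preVariation_eq _ _ hA]
    refine iSup_le fun P => ?_
    have e : ∑ p ∈ P.parts, l.gauge (fun t => ‖t‖ₑ) p =
        ∑ B ∈ (P.parts.map (Function.Embedding.subtype _)).filter (· ∈ ringSets), ‖l B‖ₑ := by
      rw [Finset.sum_filter, Finset.sum_map]
      rfl
    rw [e]
    refine le_iSup_of_le _ (le_iSup_of_le ?_ (le_iSup_of_le ?_ le_rfl))
    · intro B hB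
      simp only [Finset.mem_filter, Finset.mem_map, Function.Embedding.subtype_apply] at hB
      obtain ⟨⟨p, hp, rfl⟩, hB⟩ := hB
      exact ⟨hB, P.le hp⟩
    · intro B hB C hC hBC
      simp only [Finset.coe_filter, Finset.mem_map, Function.Embedding.subtype_apply,
        mem_ofPred_eq] at hB hC
      obtain ⟨⟨p, hp, rfl⟩, _⟩ := hB
      obtain ⟨⟨r, hr, rfl⟩, _⟩ := hC
      have := P.disjoint hp hr (by rintro rfl; exact hBC rfl)
      simpa [Function.onFun, disjoint_iff, Subtype.ext_iff] using this
  · refine iSup_le fun P => iSup_le fun hP => iSup_le fun hd => ?_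
    calc ∑ B ∈ P, ‖l B‖ₑ ≤ ∑ B ∈ P, l.variation B := by
          refine Finset.sum_le_sum fun B hB => ?_
          refine le_trans ?_ (le_preVariation _ _ (measurableSet_of_mem (hP B hB).1))
          simp [gauge, (hP B hB).1]
      _ = l.variation (⋃ B ∈ P, B) :=
          (measure_biUnion_finset hd fun B hB => measurableSet_of_mem (hP B hB).1).symm
      _ ≤ l.variation A := measure_mono (iUnion₂_subset fun B hB => (hP B hB).2)

theorem enorm_le_variation {A : Set Ω} (hA : A ∈ ringSets) : ‖l A‖ₑ ≤ l.variation A := by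
  refine le_trans ?_ (le_preVariation _ _ (measurableSet_of_mem hA))
  simp [gauge, hA]

theorem posVariation_le : l.posVariation ≤ l.variation := by
  refine Measure.le_iff.2 fun A hA => preVariation_le _ _ hA fun B _ hB => ?_
  by_cases h : B ∈ ringSets
  · refine le_trans ?_ (l.enorm_le_variation h)
    simp only [gauge, h, if_true]
    rw [← ofReal_norm]
    exact ENNReal.ofReal_le_ofReal (le_abs_self _)
  · simp [gauge, h]

theorem negVariation_le : l.negVariation ≤ l.variation := by
  refine Measure.le_iff.2 fun A hA => preVariation_le _ _ hA fun B _ hB => ?_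
  by_cases h : B ∈ ringSets
  · refine le_trans ?_ (l.enorm_le_variation h)
    simp only [gauge, h, if_true]
    rw [← ofReal_norm]
    exact ENNReal.ofReal_le_ofReal (neg_le_abs _)
  · simp [gauge, h]

/-- The variation is finite on the `δ`-ring. -/
theorem variation_lt_top {A : Set Ω} (hA : A ∈ ringSets) : l.variation A < ∞ := by
  have : l.variation A ≤ (SignedMeasure.totalVariation (l.trace A hA)) A := by
    refine preVariation_le _ _ (measurableSet_of_mem hA) fun B hBA hB => ?_
    have hB' := mem_of_subset hB hA hBA
    simp only [gauge, hB', if_true]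
    have := SignedMeasure.enorm_le_totalVariation (l.trace A hA) B
    rwa [trace_apply _ _ hB, inter_eq_self_of_subset_left hBA] at this
  refine this.trans_lt ?_
  simp only [SignedMeasure.totalVariation]
  exact measure_lt_top _ _

theorem sum_parts {A : Set Ω} (hA : A ∈ ringSets)
    (P : Finpartition (⟨A, measurableSet_of_mem hA⟩ : Subtype MeasurableSet)) :
    ∑ p ∈ P.parts, l p = l A := by
  have h := VectorMeasure.sum_finpartition (l.trace A hA) P
  rw [trace_apply _ _ (measurableSet_of_mem hA), inter_self] at h
  rw [← h]
  refine Finset.sum_congr rfl fun p hp => ?_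
  rw [trace_apply _ _ p.2, inter_eq_self_of_subset_left (P.le hp)]

/-- Jordan decomposition: `l = l⁺ - l⁻` on the `δ`-ring. -/
theorem posVariation_sub_negVariation {A : Set Ω} (hA : A ∈ ringSets) :
    l.posVariation.real A - l.negVariation.real A = l A := by
  have hm := measurableSet_of_mem hA
  have key : l.posVariation A + ENNReal.ofReal (-l A) =
      l.negVariation A + ENNReal.ofReal (l A) := by
    rw [posVariation, negVariation, preVariation_eq _ _ hm, preVariation_eq _ _ hm,
      ENNReal.iSup_add, ENNReal.iSup_add]
    refine iSup_congr fun P => ?_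
    have hp : ∀ p ∈ P.parts, p.val ∈ ringSets := fun p hp => mem_of_subset p.2 hA (P.le hp)
    have e : ∀ g : ℝ → ℝ≥0∞, ∑ p ∈ P.parts, l.gauge g p = ∑ p ∈ P.parts, g (l p) := fun g =>
      Finset.sum_congr rfl fun p h => by simp [gauge, hp p h]
    rw [e, e]
    have r : ∀ t : ℝ, ENNReal.ofReal t = ENNReal.ofReal (max t 0) := fun t => by simp
    have e1 : ∀ g : Subtype (MeasurableSet (α := Ω)) → ℝ, ∑ p ∈ P.parts, ENNReal.ofReal (g p) =
        ENNReal.ofReal (∑ p ∈ P.parts, max (g p) 0) := fun g => by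
      rw [ENNReal.ofReal_sum_of_nonneg fun i _ => le_max_right _ _]
      exact Finset.sum_congr rfl fun p _ => r _
    have n1 : ∀ g : Subtype (MeasurableSet (α := Ω)) → ℝ, 0 ≤ ∑ p ∈ P.parts, max (g p) 0 :=
      fun g => Finset.sum_nonneg fun i _ => le_max_right _ _
    rw [e1 (fun p => l p), e1 (fun p => -l p), r (l A), r (-l A),
      ← ENNReal.ofReal_add (n1 _) (le_max_right _ _),
      ← ENNReal.ofReal_add (n1 _) (le_max_right _ _)]
    congr 1
    have j : ∀ t : ℝ, max t 0 - max (-t) 0 = t := fun t => by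
      rcases le_total t 0 with h | h <;> simp [h]
    have s := l.sum_parts hA P
    have s' : ∑ p ∈ P.parts, max (l p) 0 - ∑ p ∈ P.parts, max (-l p) 0 = l A := by
      rw [← Finset.sum_sub_distrib, ← s]
      exact Finset.sum_congr rfl fun p _ => j _
    linarith [j (l A)]
  have hp : l.posVariation A ≠ ∞ :=
    ((l.posVariation_le A).trans_lt (l.variation_lt_top hA)).ne
  have hn : l.negVariation A ≠ ∞ :=
    ((l.negVariation_le A).trans_lt (l.variation_lt_top hA)).ne
  have h := congrArg ENNReal.toReal key
  rw [ENNReal.toReal_add hp ENNReal.ofReal_ne_top, ENNReal.toReal_add hn ENNReal.ofReal_ne_top,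
    ENNReal.toReal_ofReal', ENNReal.toReal_ofReal'] at h
  have j : max (l A) 0 - max (-l A) 0 = l A := by
    rcases le_total (l A) 0 with h | h <;> simp [h]
  simp only [measureReal_def]
  linarith

/-- The integral `∫_A f dl` of a function `f ∈ L¹(|l|)` over a set `A ∈ 𝓡^loc`. It is linear in
`f` and continuous for the norm of `L¹(|l|)`, with the natural value on simple functions supported
in the `δ`-ring; see `setIntegral_simple` and `tendsto_setIntegral`. -/
noncomputable def setIntegral (A : Set Ω) (f : Ω → ℝ) : ℝ :=
  ∫ x in A, f x ∂l.posVariation - ∫ x in A, f x ∂l.negVariation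

theorem setIntegral_congr (A : Set Ω) {f g : Ω → ℝ} (h : f =ᵐ[l.variation] g) :
    l.setIntegral A f = l.setIntegral A g := by
  rw [setIntegral, setIntegral,
    integral_congr_ae (ae_restrict_of_ae (ae_mono l.posVariation_le h)),
    integral_congr_ae (ae_restrict_of_ae (ae_mono l.negVariation_le h))]

theorem setIntegral_add (A : Set Ω) {f g : Ω → ℝ} (hf : Integrable f l.variation)
    (hg : Integrable g l.variation) :
    l.setIntegral A (f + g) = l.setIntegral A f + l.setIntegral A g := by
  have p := l.posVariation_le
  have n := l.negVariation_le
  simp only [setIntegral, Pi.add_apply]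
  rw [integral_add (hf.mono_measure p).integrableOn (hg.mono_measure p).integrableOn,
    integral_add (hf.mono_measure n).integrableOn (hg.mono_measure n).integrableOn]
  ring

theorem setIntegral_smul (A : Set Ω) (c : ℝ) (f : Ω → ℝ) :
    l.setIntegral A (c • f) = c * l.setIntegral A f := by
  simp only [setIntegral, Pi.smul_apply, smul_eq_mul, integral_const_mul]
  ring

/-- `∫_A ∑ aⱼ χ_{Aⱼ} dl = ∑ aⱼ l(Aⱼ ∩ A)` for `Aⱼ` in the `δ`-ring. -/
theorem setIntegral_simple {ι : Type*} (s : Finset ι) (a : ι → ℝ) (B : ι → Set Ω)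
    (hB : ∀ j ∈ s, B j ∈ ringSets) {A : Set Ω} (hA : MeasurableSet A) :
    l.setIntegral A (fun x => ∑ j ∈ s, (B j).indicator (fun _ => a j) x) =
      ∑ j ∈ s, a j * l (B j ∩ A) := by
  have hBm : ∀ j ∈ s, MeasurableSet (B j) := fun j hj => measurableSet_of_mem (hB j hj)
  have hBA : ∀ j ∈ s, B j ∩ A ∈ ringSets := fun j hj => by
    rw [inter_comm]; exact hA _ (hB j hj)
  have aux : ∀ μ : Measure Ω, μ ≤ l.variation →
      ∫ x in A, ∑ j ∈ s, (B j).indicator (fun _ => a j) x ∂μ =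
        ∑ j ∈ s, a j * μ.real (B j ∩ A) := fun μ hμ => by
    rw [integral_finsetSum]
    · refine Finset.sum_congr rfl fun j hj => ?_
      rw [integral_indicator (hBm j hj), setIntegral_const, smul_eq_mul, mul_comm,
        measureReal_restrict_apply (hBm j hj)]
    · intro j hj
      refine IntegrableOn.integrable ?_
      rw [integrableOn_indicator_iff (hBm j hj)]
      refine integrableOn_const ?_
      refine (lt_of_le_of_lt ?_ (l.variation_lt_top (hB j hj))).ne
      exact (measure_mono inter_subset_left).trans (hμ _)
  rw [setIntegral, aux _ l.posVariation_le, aux _ l.negVariation_le, ← Finset.sum_sub_distrib]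
  refine Finset.sum_congr rfl fun j hj => ?_
  rw [← mul_sub, l.posVariation_sub_negVariation (hBA j hj)]

/-- If `φₙ → f` in `L¹(|l|)` then `∫_A φₙ dl → ∫_A f dl`. -/
theorem tendsto_setIntegral (A : Set Ω) {f : Ω → ℝ} {φ : ℕ → Ω → ℝ}
    (hf : Integrable f l.variation) (hφ : ∀ n, Integrable (φ n) l.variation)
    (h : Tendsto (fun n => ∫⁻ x, ‖φ n x - f x‖ₑ ∂l.variation) atTop (𝓝 0)) :
    Tendsto (fun n => l.setIntegral A (φ n)) atTop (𝓝 (l.setIntegral A f)) := by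
  have aux : ∀ μ : Measure Ω, μ ≤ l.variation →
      Tendsto (fun n => ∫ x in A, φ n x ∂μ) atTop (𝓝 (∫ x in A, f x ∂μ)) := fun μ hμ => by
    refine tendsto_setIntegral_of_L1 f (hf.mono_measure hμ).aestronglyMeasurable
      (Eventually.of_forall fun n => (hφ n).mono_measure hμ) ?_ A
    exact tendsto_of_tendsto_of_tendsto_of_le_of_le tendsto_const_nhds h (fun _ => zero_le)
      fun n => lintegral_mono' hμ le_rfl
  exact (aux _ l.posVariation_le).sub (aux _ l.negVariation_le)

end Scalar

section Vector

/-! ### Integration with respect to a vector measure on a `δ`-ring -/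

variable {E : Type*} [NormedAddCommGroup E] [NormedSpace ℝ E] (m : RingVectorMeasure Ω E)

/-- A measure on `𝓡^loc` whose null sets are the `m`-null sets, see `controlMeasure_eq_zero_iff`;
it serves only to identify functions that are equal `m`-a.e. -/
noncomputable def controlMeasure : Measure Ω :=
  Measure.sum fun x' : StrongDual ℝ E => (m.comp x').variation

theorem variation_le_controlMeasure (x' : StrongDual ℝ E) :
    (m.comp x').variation ≤ m.controlMeasure :=
  Measure.le_sum (fun x' : StrongDual ℝ E => (m.comp x').variation) x'

theorem controlMeasure_eq_zero_iff {A : Set Ω} (hA : MeasurableSet A) :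
    m.controlMeasure A = 0 ↔ ∀ B ∈ ringSets, B ⊆ A → m B = 0 := by
  rw [controlMeasure, Measure.sum_apply _ hA, ENNReal.tsum_eq_zero]
  constructor
  · intro h B hB hBA
    refine (SeparatingDual.eq_zero_iff_forall_dual_eq_zero (R := ℝ) (m B)).2 fun x' => ?_
    have := ((m.comp x').enorm_le_variation hB).trans ((measure_mono hBA).trans (h x').le)
    simpa [comp] using this
  · intro h x'
    rw [variation_apply _ hA]
    simp only [ENNReal.iSup_eq_zero, Finset.sum_eq_zero_iff]
    intro P hP _ B hB
    simp [comp, h B (hP B hB).1 (hP B hB).2]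

/-- `L⁰(m)`: classes of real functions measurable with respect to `𝓡^loc`, where functions that
are equal `m`-a.e. are identified. -/
abbrev L0 : Type _ := Ω →ₘ[m.controlMeasure] ℝ

/-- `x = ∫_A f dm`, that is, `x*(x) = ∫_A f d(x* m)` for every `x* ∈ E*`. -/
def HasIntegralOn (f : Ω → ℝ) (A : Set Ω) (x : E) : Prop :=
  ∀ x' : StrongDual ℝ E, x' x = (m.comp x').setIntegral A f

theorem HasIntegralOn.unique {f : Ω → ℝ} {A : Set Ω} {x y : E} (hx : m.HasIntegralOn f A x)
    (hy : m.HasIntegralOn f A y) : x = y :=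
  (SeparatingDual.eq_iff_forall_dual_eq (R := ℝ)).2 fun x' => (hx x').trans (hy x').symm

theorem ae_variation {p : Ω → Prop} (h : ∀ᵐ x ∂m.controlMeasure, p x) (x' : StrongDual ℝ E) :
    ∀ᵐ x ∂(m.comp x').variation, p x := ae_mono (m.variation_le_controlMeasure x') h

theorem HasIntegralOn.congr {f g : Ω → ℝ} {A : Set Ω} {x : E} (hx : m.HasIntegralOn f A x)
    (h : f =ᵐ[m.controlMeasure] g) : m.HasIntegralOn g A x := fun x' =>
  (hx x').trans (setIntegral_congr _ A (m.ae_variation h x'))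

theorem HasIntegralOn.add {f g : Ω → ℝ} {A : Set Ω} {x y : E}
    (hf : ∀ x' : StrongDual ℝ E, Integrable f (m.comp x').variation)
    (hg : ∀ x' : StrongDual ℝ E, Integrable g (m.comp x').variation)
    (hx : m.HasIntegralOn f A x) (hy : m.HasIntegralOn g A y) :
    m.HasIntegralOn (f + g) A (x + y) := fun x' => by
  rw [setIntegral_add _ A (hf x') (hg x'), map_add, hx x', hy x']

theorem HasIntegralOn.smul {f : Ω → ℝ} {A : Set Ω} {x : E} (c : ℝ)
    (hx : m.HasIntegralOn f A x) : m.HasIntegralOn (c • f) A (c • x) := fun x' => by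
  rw [setIntegral_smul, map_smul, hx x', smul_eq_mul]

/-- `L¹_w(m)`: the weakly integrable functions, `f ∈ L¹(x* m)` for every `x* ∈ E*`. -/
def L1w : Submodule ℝ m.L0 where
  carrier := {f | ∀ x' : StrongDual ℝ E, Integrable f (m.comp x').variation}
  zero_mem' x' :=
    (integrable_zero Ω ℝ _).congr (m.ae_variation AEEqFun.coeFn_zero.symm x')
  add_mem' {f g} hf hg x' :=
    ((hf x').add (hg x')).congr (m.ae_variation (AEEqFun.coeFn_add f g).symm x')
  smul_mem' c f hf x' :=
    ((hf x').smul c).congr (m.ae_variation (AEEqFun.coeFn_smul c f).symm x')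

/-- `L¹(m)`: the integrable functions, i.e. the `f ∈ L¹_w(m)` for which `∫_A f dm` exists in `E`
for every `A ∈ 𝓡^loc`. -/
def L1 : Submodule ℝ m.L0 where
  carrier := {f | f ∈ m.L1w ∧ ∀ A : Set Ω, MeasurableSet A → ∃ x : E, m.HasIntegralOn f A x}
  zero_mem' := ⟨m.L1w.zero_mem, fun A _ => ⟨0, by
    refine HasIntegralOn.congr m (f := 0) (fun x' => ?_) AEEqFun.coeFn_zero.symm
    simp [setIntegral]⟩⟩
  add_mem' {f g} hf hg := ⟨m.L1w.add_mem hf.1 hg.1, fun A hA => by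
    obtain ⟨x, hx⟩ := hf.2 A hA
    obtain ⟨y, hy⟩ := hg.2 A hA
    exact ⟨x + y, (HasIntegralOn.add m hf.1 hg.1 hx hy).congr m (AEEqFun.coeFn_add f g).symm⟩⟩
  smul_mem' c f hf := ⟨m.L1w.smul_mem c hf.1, fun A hA => by
    obtain ⟨x, hx⟩ := hf.2 A hA
    exact ⟨c • x, (HasIntegralOn.smul m c hx).congr m (AEEqFun.coeFn_smul c f).symm⟩⟩

/-- The norm `‖f‖_m = sup ∫ |f| d|x* m|`, over `x*` in the closed unit ball of `E*`. It is written
with values in `[0, ∞]` to be defined on all of `L⁰(m)`. -/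
noncomputable def normL1 (f : m.L0) : ℝ≥0∞ :=
  ⨆ (x' : StrongDual ℝ E) (_ : ‖x'‖ ≤ 1), ∫⁻ ω, ‖f ω‖ₑ ∂(m.comp x').variation

/-- The integration operator `I_m : L¹(m) → E`, `I_m(f) = ∫_Ω f dm`. -/
noncomputable def integrationOperator : m.L1 →ₗ[ℝ] E where
  toFun f := (f.2.2 univ MeasurableSet.univ).choose
  map_add' f g := by
    have hf := (f.2.2 univ MeasurableSet.univ).choose_spec
    have hg := (g.2.2 univ MeasurableSet.univ).choose_spec
    exact HasIntegralOn.unique m ((f + g).2.2 univ MeasurableSet.univ).choose_spec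
      ((HasIntegralOn.add m f.2.1 g.2.1 hf hg).congr m (AEEqFun.coeFn_add f.1 g.1).symm)
  map_smul' c f := by
    have hf := (f.2.2 univ MeasurableSet.univ).choose_spec
    exact HasIntegralOn.unique m ((c • f).2.2 univ MeasurableSet.univ).choose_spec
      ((HasIntegralOn.smul m c hf).congr m (AEEqFun.coeFn_smul c f.1).symm)

theorem integrationOperator_spec (f : m.L1) :
    m.HasIntegralOn f univ (m.integrationOperator f) :=
  (f.2.2 univ MeasurableSet.univ).choose_spec

end Vector

end RingVectorMeasure

section Concavity

variable {Ω : Type*} [MeasurableSpace Ω] {μ : Measure Ω}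

/-- The function `(∑ⱼ |fⱼ|^q)^(1/q)`. -/
noncomputable def lqSum (q : ℝ) {n : ℕ} (f : Fin n → (Ω →ₘ[μ] ℝ)) : Ω →ₘ[μ] ℝ :=
  AEEqFun.mk (fun ω => (∑ j, |f j ω| ^ q) ^ (1 / q)) (by
    refine AEMeasurable.aestronglyMeasurable ?_
    have h : ∀ j, AEMeasurable (f j) μ := fun j => (f j).aemeasurable
    fun_prop)

/-- A linear operator `T : X → F` on a space `X` of classes of measurable functions is `q`-concave
if there is a finite `C > 0` with `(∑ⱼ ‖T fⱼ‖^q)^(1/q) ≤ C ‖(∑ⱼ |fⱼ|^q)^(1/q)‖_X` for all finite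
families `(fⱼ)` in `X`. The norms of `X` and `F` are the arguments `normX` and `normF`. -/
def IsQConcave (q : ℝ) {X : Submodule ℝ (Ω →ₘ[μ] ℝ)} (normX : (Ω →ₘ[μ] ℝ) → ℝ≥0∞)
    {F : Type*} [AddCommGroup F] [Module ℝ F] (normF : F → ℝ≥0∞) (T : X →ₗ[ℝ] F) : Prop :=
  ∃ C : ℝ≥0, 0 < C ∧ ∀ (n : ℕ) (f : Fin n → X),
    (∑ j, normF (T (f j)) ^ q) ^ (1 / q) ≤ C * normX (lqSum q fun j => (f j : Ω →ₘ[μ] ℝ))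

/-- The function space `X` with norm `normX` is `q`-concave if its identity map is. -/
def IsQConcaveSpace (q : ℝ) (X : Submodule ℝ (Ω →ₘ[μ] ℝ)) (normX : (Ω →ₘ[μ] ℝ) → ℝ≥0∞) : Prop :=
  IsQConcave q normX (fun f : X => normX f) LinearMap.id

end Concavity

/-! ### Real measures on a `δ`-ring: Hahn decomposition and the `L¹`-norm -/

namespace RingVectorMeasure

section Scalar

variable {Ω : Type*} [DeltaRing Ω] (l : RingVectorMeasure Ω ℝ)

/-! The operator norm of `I_m` and the norm of `L¹(m)` are linked in two ways. `I_m` is bounded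
(`enorm_integrationOperator_le`), so concavity of the identity passes to `I_m`. Conversely, each `f`
admits a set `A` with `‖f‖_m ≤ 8 ‖I_m(f χ_A)‖` (`exists_normL1_le_enorm_integral`). Given `f₁, …,
fₙ`, choose such `Aⱼ` and apply the concavity of `I_m` to the functions `fⱼ χ_{Aⱼ}`. Since `|fⱼ
χ_{Aⱼ}| ≤ |fⱼ|` and the norm respects the order, the right-hand side is at most the one for the `fⱼ`
(`normL1_lqSum_indicatorL1_le`).

The existence of `A` rests on a scalar estimate, `lintegral_enorm_le_of_enorm_setIntegral_le`: four
sets, cut out by a Hahn set and by the sign of `f`, reduce `∫ |f| d|l|` to absolute values of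
integrals of `f`. Applied to every `x* m`, it bounds `‖f‖_m` by four times the supremum of `‖∫_A f
dm‖` over `A`. Uniform boundedness makes that supremum finite, so some `A` comes within a factor two
of it when `‖f‖_m ≠ 0`. -/

theorem variation_le_posVariation_add_negVariation :
    l.variation ≤ l.posVariation + l.negVariation := by
  refine Measure.le_iff.2 fun A hA => preVariation_le _ _ hA fun B _ hB => ?_
  have hp : l.gauge (fun t => ENNReal.ofReal t) B ≤ l.posVariation B := le_preVariation _ _ hB
  have hn : l.gauge (fun t => ENNReal.ofReal (-t)) B ≤ l.negVariation B := le_preVariation _ _ hB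
  refine le_trans ?_ (add_le_add hp hn)
  by_cases h : B ∈ ringSets
  · simp only [gauge, h, if_true]
    rcases le_total 0 (l B) with h0 | h0
    · simp [Real.enorm_eq_ofReal h0]
    · rw [← enorm_neg, Real.enorm_eq_ofReal (neg_nonneg.2 h0)]
      exact le_add_self
  · simp [gauge, h]

theorem posVariation_ne_top {A : Set Ω} (hA : A ∈ ringSets) : l.posVariation A ≠ ∞ :=
  ((l.posVariation_le A).trans_lt (l.variation_lt_top hA)).ne

theorem negVariation_ne_top {A : Set Ω} (hA : A ∈ ringSets) : l.negVariation A ≠ ∞ :=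
  ((l.negVariation_le A).trans_lt (l.variation_lt_top hA)).ne

/-- On members `B ⊆ A` of the `δ`-ring the Jordan decomposition gives `l(B) ≥ 0`, so every term of
the supremum defining `l⁻(A)` vanishes. Subtracting is legitimate because `l⁺` and `l⁻` are finite
on the `δ`-ring. -/
theorem negVariation_eq_zero_of_le_posVariation {A : Set Ω} (hA : MeasurableSet A)
    (h : ∀ B ⊆ A, MeasurableSet B → l.negVariation B ≤ l.posVariation B) :
    l.negVariation A = 0 := by
  refine nonpos_iff_eq_zero.1 (preVariation_le (μ := 0) _ _ hA fun B hBA hB => ?_)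
  by_cases hR : B ∈ ringSets
  · have := ENNReal.toReal_mono (l.posVariation_ne_top hR) (h B hBA hB)
    have e := l.posVariation_sub_negVariation hR
    simp only [measureReal_def] at e
    simp only [gauge, hR, if_true, Measure.coe_zero, Pi.zero_apply, nonpos_iff_eq_zero,
      ENNReal.ofReal_eq_zero]
    linarith
  · simp [gauge, hR]

theorem posVariation_eq_zero_of_le_negVariation {A : Set Ω} (hA : MeasurableSet A)
    (h : ∀ B ⊆ A, MeasurableSet B → l.posVariation B ≤ l.negVariation B) :
    l.posVariation A = 0 := by
  refine nonpos_iff_eq_zero.1 (preVariation_le (μ := 0) _ _ hA fun B hBA hB => ?_)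
  by_cases hR : B ∈ ringSets
  · have := ENNReal.toReal_mono (l.negVariation_ne_top hR) (h B hBA hB)
    have e := l.posVariation_sub_negVariation hR
    simp only [measureReal_def] at e
    simp only [gauge, hR, if_true, Measure.coe_zero, Pi.zero_apply, nonpos_iff_eq_zero,
      ENNReal.ofReal_eq_zero]
    linarith
  · simp [gauge, hR]

/-- An inequality between measures with the density `g` passes to the measures themselves where
`g` is positive. -/
theorem measure_le_of_withDensity_le {Ω : Type*} [MeasurableSpace Ω] {μ ν : Measure Ω}
    {g : Ω → ℝ≥0∞} (hg : Measurable g) (hg' : ∀ x, g x ≠ ∞) {A : Set Ω} (hA : MeasurableSet A)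
    (h0 : ∀ x ∈ A, g x ≠ 0)
    (h : (μ.withDensity g).restrict A ≤ (ν.withDensity g).restrict A) : μ A ≤ ν A := by
  -- Integrating `g⁻¹` undoes the density, as `g` is neither `0` nor `∞` on `A`.
  have key : ∀ ρ : Measure Ω, ∫⁻ x in A, (g x)⁻¹ ∂ρ.withDensity g = ρ A := fun ρ => by
    rw [setLIntegral_withDensity_eq_setLIntegral_mul ρ hg (g := fun x => (g x)⁻¹) hg.inv hA,
      ← setLIntegral_one]
    exact setLIntegral_congr_fun hA fun x hx => ENNReal.mul_inv_cancel (h0 x hx) (hg' x)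
  rw [← key μ, ← key ν]
  exact lintegral_mono' h le_rfl

/-- A Hahn decomposition of the support of an integrable function. -/
theorem exists_hahn_of_integrable {f : Ω → ℝ} (hfm : Measurable f)
    (hf : Integrable f l.variation) :
    ∃ P : Set Ω, MeasurableSet P ∧ l.negVariation (P ∩ {x | f x ≠ 0}) = 0 ∧
      l.posVariation (Pᶜ ∩ {x | f x ≠ 0}) = 0 := by
  have hg : Measurable fun x => ‖f x‖ₑ := hfm.enorm
  -- `l⁺` and `l⁻` may be infinite on `Ω`. With the density `|f|` they become finite, so that a Hahn
  -- decomposition exists; it says something about `l⁺` and `l⁻` only where `f ≠ 0`.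
  have fin : ∀ μ : Measure Ω, μ ≤ l.variation →
      IsFiniteMeasure (μ.withDensity fun x => ‖f x‖ₑ) := fun μ hμ =>
    isFiniteMeasure_withDensity (hf.mono_measure hμ).hasFiniteIntegral.ne
  have := fin _ l.posVariation_le
  have := fin _ l.negVariation_le
  obtain ⟨P, hP⟩ := exists_isHahnDecomposition
    (l.negVariation.withDensity fun x => ‖f x‖ₑ) (l.posVariation.withDensity fun x => ‖f x‖ₑ)
  have hs : MeasurableSet {x | f x ≠ 0} := hfm (measurableSet_singleton 0).compl
  refine ⟨P, hP.measurableSet, l.negVariation_eq_zero_of_le_posVariation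
    (hP.measurableSet.inter hs) fun B hB hBm => ?_, l.posVariation_eq_zero_of_le_negVariation
    (hP.measurableSet.compl.inter hs) fun B hB hBm => ?_⟩
  · refine measure_le_of_withDensity_le hg (fun x => enorm_ne_top) hBm
      (fun x hx => by simpa using (hB hx).2) ?_
    have := Measure.restrict_mono_measure hP.le_on B
    rwa [Measure.restrict_restrict_of_subset fun x hx => (hB hx).1,
      Measure.restrict_restrict_of_subset fun x hx => (hB hx).1] at this
  · refine measure_le_of_withDensity_le hg (fun x => enorm_ne_top) hBm
      (fun x hx => by simpa using (hB hx).2) ?_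
    have := Measure.restrict_mono_measure hP.ge_on_compl B
    rwa [Measure.restrict_restrict_of_subset fun x hx => (hB hx).1,
      Measure.restrict_restrict_of_subset fun x hx => (hB hx).1] at this

theorem setLIntegral_enorm_eq_enorm_setIntegral {Ω : Type*} [MeasurableSpace Ω] {μ : Measure Ω}
    {f : Ω → ℝ} (hf : Integrable f μ) {D : Set Ω} (hD : MeasurableSet D)
    (h : (∀ x ∈ D, 0 ≤ f x) ∨ ∀ x ∈ D, f x ≤ 0) :
    ∫⁻ x in D, ‖f x‖ₑ ∂μ = ‖∫ x in D, f x ∂μ‖ₑ := by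
  have pos : ∀ g : Ω → ℝ, Integrable g μ → (∀ x ∈ D, 0 ≤ g x) →
      ∫⁻ x in D, ‖g x‖ₑ ∂μ = ‖∫ x in D, g x ∂μ‖ₑ := fun g hg h0 => by
    rw [Real.enorm_eq_ofReal (setIntegral_nonneg hD h0),
      ofReal_integral_eq_lintegral_ofReal hg.integrableOn (ae_restrict_of_forall_mem hD h0)]
    exact setLIntegral_congr_fun hD fun x hx => Real.enorm_eq_ofReal (h0 x hx)
  rcases h with h | h
  · exact pos f hf h
  · simpa [integral_neg] using pos (-f) hf.neg fun x hx => by simpa using h x hx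

/-- The `L¹(|l|)`-norm of `f` is controlled by the integrals of `f` over measurable sets. -/
theorem lintegral_enorm_le_of_enorm_setIntegral_le {f : Ω → ℝ} (hfm : Measurable f)
    (hf : Integrable f l.variation) {S : ℝ≥0∞}
    (hS : ∀ A, MeasurableSet A → ‖l.setIntegral A f‖ₑ ≤ S) :
    ∫⁻ x, ‖f x‖ₑ ∂l.variation ≤ 4 * S := by
  obtain ⟨P, hP, hn, hp⟩ := l.exists_hahn_of_integrable hfm hf
  have hfp := hf.mono_measure l.posVariation_le
  have hfn := hf.mono_measure l.negVariation_le
  have mpos : MeasurableSet {x | 0 < f x} := measurableSet_lt measurable_const hfm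
  have mneg : MeasurableSet {x | f x < 0} := measurableSet_lt hfm measurable_const
  -- On a set where `l⁻` vanishes and `f` keeps its sign, nothing cancels: `∫_D |f| dl⁺` is the
  -- absolute value of `∫_D f dl`.
  have bp : ∀ D, MeasurableSet D → l.negVariation D = 0 →
      ((∀ x ∈ D, 0 ≤ f x) ∨ ∀ x ∈ D, f x ≤ 0) → ∫⁻ x in D, ‖f x‖ₑ ∂l.posVariation ≤ S :=
    fun D hD h0 hs => by
      rw [setLIntegral_enorm_eq_enorm_setIntegral hfp hD hs]
      simpa [setIntegral, Measure.restrict_eq_zero.2 h0] using hS D hD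
  have bn : ∀ D, MeasurableSet D → l.posVariation D = 0 →
      ((∀ x ∈ D, 0 ≤ f x) ∨ ∀ x ∈ D, f x ≤ 0) → ∫⁻ x in D, ‖f x‖ₑ ∂l.negVariation ≤ S :=
    fun D hD h0 hs => by
      rw [setLIntegral_enorm_eq_enorm_setIntegral hfn hD hs]
      simpa [setIntegral, Measure.restrict_eq_zero.2 h0] using hS D hD
  -- Used with `Q = P` for `l⁺` and `Q = Pᶜ` for `l⁻`; the two signs of `f` on each side give the
  -- four pieces behind the constant `4`.
  have split : ∀ (μ : Measure Ω) (Q : Set Ω), MeasurableSet Q → μ (Qᶜ ∩ {x | f x ≠ 0}) = 0 →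
      ∫⁻ x, ‖f x‖ₑ ∂μ ≤ ∫⁻ x in Q ∩ {x | 0 < f x}, ‖f x‖ₑ ∂μ +
        ∫⁻ x in Q ∩ {x | f x < 0}, ‖f x‖ₑ ∂μ := fun μ Q hQ h0 => by
    rw [← lintegral_indicator (hQ.inter mpos), ← lintegral_indicator (hQ.inter mneg),
      ← lintegral_add_left (hfm.enorm.indicator (hQ.inter mpos))]
    refine lintegral_mono_ae ?_
    filter_upwards [measure_eq_zero_iff_ae_notMem.1 h0] with x hx
    rcases lt_trichotomy (f x) 0 with h | h | h
    · have : x ∈ Q := by by_contra hQ; exact hx ⟨hQ, h.ne⟩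
      simp [this, h, indicator]
    · simp [h]
    · have : x ∈ Q := by by_contra hQ; exact hx ⟨hQ, h.ne'⟩
      simp [this, h, indicator]
  calc ∫⁻ x, ‖f x‖ₑ ∂l.variation
      ≤ ∫⁻ x, ‖f x‖ₑ ∂(l.posVariation + l.negVariation) :=
        lintegral_mono' l.variation_le_posVariation_add_negVariation le_rfl
    _ = ∫⁻ x, ‖f x‖ₑ ∂l.posVariation + ∫⁻ x, ‖f x‖ₑ ∂l.negVariation := lintegral_add_measure _ _ _
    _ ≤ (S + S) + (S + S) := by
        refine add_le_add ((split _ P hP hp).trans (add_le_add ?_ ?_))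
          ((split _ Pᶜ hP.compl (by rwa [compl_compl])).trans (add_le_add ?_ ?_))
        · exact bp _ (hP.inter mpos) (measure_mono_null
            (inter_subset_inter_right _ fun x hx => ne_of_gt hx) hn)
            (Or.inl fun x hx => hx.2.le)
        · exact bp _ (hP.inter mneg) (measure_mono_null
            (inter_subset_inter_right _ fun x hx => ne_of_lt hx) hn)
            (Or.inr fun x hx => hx.2.le)
        · exact bn _ (hP.compl.inter mpos) (measure_mono_null
            (inter_subset_inter_right _ fun x hx => ne_of_gt hx) hp)
            (Or.inl fun x hx => hx.2.le)
        · exact bn _ (hP.compl.inter mneg) (measure_mono_null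
            (inter_subset_inter_right _ fun x hx => ne_of_lt hx) hp)
            (Or.inr fun x hx => hx.2.le)
    _ = 4 * S := by ring

/-- The factor `2` comes from bounding `l⁺` and `l⁻` separately by `|l|`; only its independence of
`A` and `f` matters. -/
theorem enorm_setIntegral_le (A : Set Ω) (f : Ω → ℝ) :
    ‖l.setIntegral A f‖ₑ ≤ 2 * ∫⁻ x, ‖f x‖ₑ ∂l.variation := by
  have b : ∀ μ : Measure Ω, μ ≤ l.variation →
      ‖∫ x in A, f x ∂μ‖ₑ ≤ ∫⁻ x, ‖f x‖ₑ ∂l.variation := fun μ hμ =>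
    (enorm_integral_le_lintegral_enorm _).trans
      (lintegral_mono' (Measure.restrict_le_self.trans hμ) le_rfl)
  rw [two_mul]
  exact enorm_sub_le.trans (add_le_add (b _ l.posVariation_le) (b _ l.negVariation_le))

theorem setIntegral_indicator {A : Set Ω} (hA : MeasurableSet A) (B : Set Ω) (f : Ω → ℝ) :
    l.setIntegral B (A.indicator f) = l.setIntegral (B ∩ A) f := by
  simp only [setIntegral, MeasureTheory.setIntegral_indicator hA]

end Scalar

end RingVectorMeasure

/-! ### The norm of `L¹(m)` and the integrals over measurable sets -/

namespace RingVectorMeasure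

section Vector

variable {Ω : Type*} [DeltaRing Ω] {E : Type*} [NormedAddCommGroup E] [NormedSpace ℝ E]
  (m : RingVectorMeasure Ω E)

/-- The product `f χ_A` of a function in `L¹(m)` with a characteristic function. -/
noncomputable def indicatorL1 {A : Set Ω} (hA : MeasurableSet A) (f : m.L1) : m.L1 :=
  ⟨AEEqFun.mk (A.indicator f.1) (f.1.aestronglyMeasurable.indicator hA), fun x' =>
    ((f.2.1 x').indicator hA).congr (m.ae_variation (AEEqFun.coeFn_mk _ _).symm x'),
    fun B hB => by
      obtain ⟨x, hx⟩ := f.2.2 (B ∩ A) (hB.inter hA)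
      refine ⟨x, HasIntegralOn.congr m (fun x' => ?_) (AEEqFun.coeFn_mk _ _).symm⟩
      rw [setIntegral_indicator _ hA, hx x']⟩

theorem coeFn_indicatorL1 {A : Set Ω} (hA : MeasurableSet A) (f : m.L1) :
    (m.indicatorL1 hA f : m.L0) =ᵐ[m.controlMeasure] A.indicator f.1 :=
  AEEqFun.coeFn_mk _ _

/-- This expresses integrals over `A` as values of `I_m`, so that a hypothesis on `I_m` alone
applies to them. -/
theorem hasIntegralOn_integrationOperator_indicatorL1 {A : Set Ω} (hA : MeasurableSet A)
    (f : m.L1) : m.HasIntegralOn f.1 A (m.integrationOperator (m.indicatorL1 hA f)) := fun x' => by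
  rw [m.integrationOperator_spec _ x', setIntegral_congr _ _
    (m.ae_variation (m.coeFn_indicatorL1 hA f) x'), setIntegral_indicator _ hA, univ_inter]

theorem normL1_mono {f g : m.L0} (h : ∀ᵐ x ∂m.controlMeasure, ‖f x‖ₑ ≤ ‖g x‖ₑ) :
    m.normL1 f ≤ m.normL1 g :=
  iSup₂_mono fun x' _ => lintegral_mono_ae (m.ae_variation h x')

theorem enorm_integrationOperator_le (f : m.L1) :
    ‖m.integrationOperator f‖ₑ ≤ 2 * m.normL1 f := by
  -- Hahn–Banach: a norming functional in the unit ball reduces the bound to the scalar measure `g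
  -- m`.
  obtain ⟨g, hg, hx⟩ := exists_dual_vector'' ℝ (m.integrationOperator f)
  have e : ‖m.integrationOperator f‖ₑ = ‖g (m.integrationOperator f)‖ₑ := by
    rw [hx]; simp
  rw [e, m.integrationOperator_spec f g]
  refine (enorm_setIntegral_le _ _ _).trans ?_
  gcongr
  exact le_iSup₂ (f := fun (x' : StrongDual ℝ E) (_ : ‖x'‖ ≤ 1) =>
    ∫⁻ ω, ‖f.1 ω‖ₑ ∂(m.comp x').variation) g hg

/-- The semivariation bound: the norm of `L¹(m)` is controlled by the norms of the integrals over
measurable sets. -/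
theorem normL1_le_of_enorm_integral_le (f : m.L1) {S : ℝ≥0∞}
    (hS : ∀ (A : Set Ω) (hA : MeasurableSet A),
      ‖m.integrationOperator (m.indicatorL1 hA f)‖ₑ ≤ S) : m.normL1 f ≤ 4 * S := by
  refine iSup₂_le fun x' hx' => lintegral_enorm_le_of_enorm_setIntegral_le _
    f.1.stronglyMeasurable.measurable (f.2.1 x') fun A hA => ?_
  rw [← m.hasIntegralOn_integrationOperator_indicatorL1 hA f x']
  refine (x'.le_opENorm _).trans (le_trans ?_ (hS A hA))
  refine mul_le_of_le_one_left zero_le ?_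
  simpa [← ofReal_norm] using hx'

/-- The integrals of `f ∈ L¹(m)` over measurable sets form a bounded subset of `E`. -/
theorem exists_norm_integral_le (f : m.L1) : ∃ K : ℝ, ∀ (A : Set Ω) (hA : MeasurableSet A),
    ‖m.integrationOperator (m.indicatorL1 hA f)‖ ≤ K := by
  -- The integrals are regarded as functionals on the Banach space `E*`. At each `x*` they are
  -- bounded by `2 ∫ |f| d|x* m|`, whatever `A` is.
  obtain ⟨K, hK⟩ := banach_steinhaus (ι := {A : Set Ω // MeasurableSet A})
    (g := fun A => NormedSpace.inclusionInDoubleDual ℝ E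
      (m.integrationOperator (m.indicatorL1 A.2 f))) (fun x' => by
    refine ⟨(2 * ∫⁻ x, ‖f.1 x‖ₑ ∂(m.comp x').variation).toReal, fun A => ?_⟩
    rw [NormedSpace.dual_def, m.hasIntegralOn_integrationOperator_indicatorL1 A.2 f x',
      ← toReal_enorm]
    exact ENNReal.toReal_mono
      (ENNReal.mul_ne_top (by simp) (f.2.1 x').hasFiniteIntegral.ne) (enorm_setIntegral_le _ _ _))
  refine ⟨K, fun A hA => ?_⟩
  rw [← (NormedSpace.inclusionInDoubleDualLi ℝ (E := E)).norm_map]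
  exact hK ⟨A, hA⟩

/-- Up to a constant, the norm of `L¹(m)` is attained at the integral over some set. -/
theorem exists_normL1_le_enorm_integral (f : m.L1) : ∃ (A : Set Ω) (hA : MeasurableSet A),
    m.normL1 f ≤ 8 * ‖m.integrationOperator (m.indicatorL1 hA f)‖ₑ := by
  by_contra! h
  obtain ⟨K, hK⟩ := m.exists_norm_integral_le f
  have top : m.normL1 f ≠ ∞ := by
    refine ((m.normL1_le_of_enorm_integral_le f (S := ENNReal.ofReal K) fun A hA => ?_).trans_lt
      (ENNReal.mul_lt_top (by simp) ENNReal.ofReal_lt_top)).ne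
    rw [← ofReal_norm]
    exact ENNReal.ofReal_le_ofReal (hK A hA)
  -- The negated claim is a strict inequality, so any one set, here `∅`, shows that the norm is
  -- positive.
  have h0 : m.normL1 f ≠ 0 := (zero_le.trans_lt (h ∅ .empty)).ne'
  -- All integrals are at most `‖f‖_m / 8`, so the semivariation bound yields `‖f‖_m ≤ ‖f‖_m / 2`,
  -- absurd for a finite positive number.
  have le : m.normL1 f ≤ 4 * (m.normL1 f / 8) :=
    m.normL1_le_of_enorm_integral_le f fun A hA => by
      rw [ENNReal.le_div_iff_mul_le (by simp) (by simp), mul_comm]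
      exact (h A hA).le
  lift m.normL1 f to ℝ≥0 using top with r
  have h0' : 0 < r := pos_iff_ne_zero.2 fun h => h0 (by simp [h])
  have e : (4 : ℝ≥0∞) * (r / 8) = ((4 * (r / 8) : ℝ≥0) : ℝ≥0∞) := by
    rw [ENNReal.coe_mul, ENNReal.coe_div (by norm_num)]; rfl
  rw [e, ENNReal.coe_le_coe, ← NNReal.coe_le_coe] at le
  push_cast at le
  have : (0 : ℝ) < r := h0'
  linarith

/-- Cutting off each `fⱼ` by its own set decreases `(∑ⱼ |fⱼ|^q)^(1/q)` pointwise, and the norm is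
monotone in the modulus. -/
theorem normL1_lqSum_indicatorL1_le {q : ℝ} (hq : 0 < q) {n : ℕ} (f : Fin n → m.L1)
    (A : Fin n → Set Ω) (hA : ∀ j, MeasurableSet (A j)) :
    m.normL1 (lqSum q fun j => (m.indicatorL1 (hA j) (f j) : m.L0)) ≤
      m.normL1 (lqSum q fun j => (f j : m.L0)) := by
  refine m.normL1_mono ?_
  have h : ∀ᵐ x ∂m.controlMeasure, ∀ j,
      (m.indicatorL1 (hA j) (f j) : m.L0) x = (A j).indicator (f j).1 x :=
    ae_all_iff.2 fun j => m.coeFn_indicatorL1 (hA j) (f j)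
  unfold lqSum
  filter_upwards [h, AEEqFun.coeFn_mk (μ := m.controlMeasure)
    (fun ω => (∑ j, |(m.indicatorL1 (hA j) (f j) : m.L0) ω| ^ q) ^ (1 / q)) _,
    AEEqFun.coeFn_mk (μ := m.controlMeasure) (fun ω => (∑ j, |(f j : m.L0) ω| ^ q) ^ (1 / q)) _]
    with x hx h1 h2
  rw [h1, h2, Real.enorm_eq_ofReal (by positivity), Real.enorm_eq_ofReal (by positivity)]
  refine ENNReal.ofReal_le_ofReal (Real.rpow_le_rpow (by positivity)
    (Finset.sum_le_sum fun j _ => Real.rpow_le_rpow (abs_nonneg _) ?_ hq.le) (by positivity))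
  rw [hx j]
  by_cases hj : x ∈ A j <;> simp [hj]

end Vector

end RingVectorMeasure

/-! ### Transfer of `q`-concavity -/

/-- Only monotonicity and homogeneity of the `ℓ^q` expression enter, not the triangle inequality;
hence `q < 1` is allowed. -/
theorem ENNReal.rpow_sum_rpow_le_mul {ι : Type*} (s : Finset ι) {q : ℝ} (hq : 0 < q) {K : ℝ≥0∞}
    {a b : ι → ℝ≥0∞} (h : ∀ j, a j ≤ K * b j) :
    (∑ j ∈ s, a j ^ q) ^ (1 / q) ≤ K * (∑ j ∈ s, b j ^ q) ^ (1 / q) := by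
  have hK : K = (K ^ q) ^ (1 / q) := by
    rw [← ENNReal.rpow_mul, mul_one_div_cancel hq.ne', ENNReal.rpow_one]
  conv_rhs => rw [hK]
  rw [← ENNReal.mul_rpow_of_nonneg _ _ (by positivity), Finset.mul_sum]
  refine ENNReal.rpow_le_rpow (Finset.sum_le_sum fun j _ => ?_) (by positivity)
  rw [← ENNReal.mul_rpow_of_nonneg _ _ hq.le]
  exact ENNReal.rpow_le_rpow (h j) hq.le

theorem mainTheorem8 {Ω : Type*} [DeltaRing Ω] {E : Type*} [NormedAddCommGroup E]
    [NormedSpace ℝ E] [CompleteSpace E] (m : RingVectorMeasure Ω E) (q : ℝ) (hq : 0 < q) :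
    IsQConcave q m.normL1 (fun x : E => ‖x‖ₑ) m.integrationOperator ↔
      IsQConcaveSpace q m.L1 m.normL1 := by
  constructor
  · rintro ⟨C, hC, h⟩
    refine ⟨8 * C, by positivity, fun n f => ?_⟩
    -- The sets depend on `j`; the concavity of `I_m` is then used for the family `fⱼ χ_{Aⱼ}`.
    choose A hA hle using fun j => m.exists_normL1_le_enorm_integral (f j)
    refine (ENNReal.rpow_sum_rpow_le_mul Finset.univ hq hle).trans ?_
    rw [ENNReal.coe_mul, mul_assoc]
    gcongr
    · simp
    · refine (h n fun j => m.indicatorL1 (hA j) (f j)).trans ?_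
      gcongr
      exact m.normL1_lqSum_indicatorL1_le hq f A hA
  · rintro ⟨C, hC, h⟩
    -- Here `2` is the bound for `I_m`, which is composed with the `q`-concave identity map.
    refine ⟨2 * C, by positivity, fun n f => ?_⟩
    refine (ENNReal.rpow_sum_rpow_le_mul Finset.univ hq fun j =>
      m.enorm_integrationOperator_le (f j)).trans ?_
    rw [ENNReal.coe_mul, mul_assoc]
    gcongr
    · simp
    · exact h n f
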